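/- Let $n\ge 2$, let $\mathcal M$ be a complex manifold of dimension $n$, and let $q\in\{1,\dots,n-1\}$. Write $\Delta^k=\{z\in\mathbb C^k:\|z\|_\infty<1\}$, where $\|z\|_\infty=\max_j|z_j|$. Let $\Omega\subset\mathcal M$ be an open set which admits an $(n-q)$-convex exhaustion function, i.e. a $\mathcal C^2$-smooth function $\rho:\Omega\to\mathbb R$ such that (a) at every point of $\Omega$ the Levi form of $\rho$ has at most $n-q-1$ non-positive eigenvalues (counted with multiplicity), and (b) for every $c\in\mathbb R$ the set $\{x\in\Omega:\rho(x)<c\}$ is relatively compact in $\Omega$. Then $\Omega$ is $q$-pseudoconvex in $\mathcal M$, i.e. for all $0<r,s<1$ and every injective holomorphic map $\Phi:\Delta^n\to\mathcal M$ such that $\Phi(H^{q,n-q}_{r,s})\subset\Omega$, one has $\Phi(\Delta^n)\subset\Omega$, where \[ H^{q,n-q}_{r,s}=\{z\in\Delta^q\times\Delta^{n-q}:\ \|(z_1,\dots,z_q)\|_\infty<r\ \text{ or }\ \|(z_{q+1},\dots,z_n)\|_\infty>s\}. \] -/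

import Mathlib

open scoped Manifold ContDiff

/-- The open unit polydisc `Δⁿ = {z ∈ ℂⁿ : max_j |z_j| < 1}`. -/
def unitPolydisc (n : ℕ) : Set (Fin n → ℂ) :=
  {z | ∀ j, ‖z j‖ < 1}

/-- The Euclidean `(q, n - q)`-Hartogs figure with parameters `r, s` in `Δⁿ = Δ^q × Δ^(n-q)`
(for `1 ≤ q < n`): the points of `Δⁿ` such that either the maximum norm of the first `q` coordinates
is less than `r`, or the maximum norm of the last `n - q` coordinates is greater than `s`. -/
def hartogsFigure (n q : ℕ) (r s : ℝ) : Set (Fin n → ℂ) :=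
  {z | z ∈ unitPolydisc n ∧
    ((∀ j : Fin n, (j : ℕ) < q → ‖z j‖ < r) ∨ (∃ j : Fin n, q ≤ (j : ℕ) ∧ s < ‖z j‖))}

/-- `Ω` is `q`-pseudoconvex in the `n`-dimensional complex manifold `M`: it satisfies the
Kontinuitätssatz with respect to `(n - q)`-polydiscs. A map `Δⁿ → M` is represented by a total
function whose values outside `Δⁿ` are irrelevant; holomorphic means complex differentiable at
every point of the open set `Δⁿ`. -/
def IsQPseudoconvex {M : Type*} [TopologicalSpace M] (n : ℕ) [ChartedSpace (Fin n → ℂ) M]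
    (q : ℕ) (Ω : Set M) : Prop :=
  ∀ r s : ℝ, 0 < r → r < 1 → 0 < s → s < 1 →
    ∀ Φ : (Fin n → ℂ) → M,
      MDifferentiableOn 𝓘(ℂ, Fin n → ℂ) 𝓘(ℂ, Fin n → ℂ) Φ (unitPolydisc n) →
      Set.InjOn Φ (unitPolydisc n) →
      Φ '' hartogsFigure n q r s ⊆ Ω →
      Φ '' unitPolydisc n ⊆ Ω

/-- The Levi matrix `(∂²φ / ∂z_j ∂z̄_k)_{j,k}` of a real function `φ` on `ℂⁿ` at the point `z`.
Here `e j` and `i e j` are the real directions `∂/∂x_j` and `∂/∂y_j`, and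
`∂/∂z_j = (∂/∂x_j - i ∂/∂y_j) / 2`, `∂/∂z̄_k = (∂/∂x_k + i ∂/∂y_k) / 2`. -/
noncomputable def leviMatrix {n : ℕ} (φ : (Fin n → ℂ) → ℝ) (z : Fin n → ℂ) :
    Matrix (Fin n) (Fin n) ℂ :=
  let D : (Fin n → ℂ) → (Fin n → ℂ) → ℝ := fun u v => fderiv ℝ (fderiv ℝ φ) z u v
  let x : Fin n → (Fin n → ℂ) := fun j => Pi.single j 1
  let y : Fin n → (Fin n → ℂ) := fun j => Pi.single j Complex.I
  Matrix.of fun j k =>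
    (1 / 4 : ℂ) * (((D (x j) (x k) + D (y j) (y k) : ℝ) : ℂ)
      + Complex.I * ((D (x j) (y k) - D (y j) (x k) : ℝ) : ℂ))

/-- The Levi matrix of a `C²` function is Hermitian. -/
theorem leviMatrix_isHermitian {n : ℕ} {φ : (Fin n → ℂ) → ℝ} {z : Fin n → ℂ}
    (hφ : ContDiffAt ℝ 2 φ z) : (leviMatrix φ z).IsHermitian := by
  have hs : IsSymmSndFDerivAt ℝ φ z := hφ.isSymmSndFDerivAt (by simp)
  ext j k
  simp only [leviMatrix, Matrix.conjTranspose_apply, Matrix.of_apply, star_mul', star_add,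
    RCLike.star_def, Complex.conj_ofReal, Complex.conj_I]
  rw [hs.eq (Pi.single k 1) (Pi.single j 1), hs.eq (Pi.single k Complex.I) (Pi.single j Complex.I),
    hs.eq (Pi.single k 1) (Pi.single j Complex.I), hs.eq (Pi.single k Complex.I) (Pi.single j 1)]
  have h4 : (starRingEnd ℂ) (1 / 4 : ℂ) = 1 / 4 := by
    rw [map_div₀, map_one, map_ofNat]
  rw [h4]
  push_cast
  ring

/-- `ψ` is a `q`-convex function on the open subset `Ω` of the `n`-dimensional complex manifold `M`
(`1 ≤ q ≤ n`): it is of class `C²` (in the real sense) on `Ω`, and at each point `p` of `Ω` its Levi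
form, computed in the holomorphic coordinates of the chart at `p`, has at most `q - 1` non-positive
eigenvalues, counted with multiplicity. The number of these eigenvalues does not depend on the
chart, and the Levi matrix is automatically Hermitian by the `C²` assumption. The values of `ψ`
outside `Ω` are irrelevant. -/
def IsQConvexOn {M : Type*} [TopologicalSpace M] (n : ℕ) [ChartedSpace (Fin n → ℂ) M]
    (q : ℕ) (ψ : M → ℝ) (Ω : Set M) : Prop :=
  ContMDiffOn 𝓘(ℝ, Fin n → ℂ) 𝓘(ℝ, ℝ) 2 ψ Ω ∧
  ∀ p ∈ Ω, ∃ h : (leviMatrix (ψ ∘ (chartAt (Fin n → ℂ) p).symm)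
      (chartAt (Fin n → ℂ) p p)).IsHermitian,
    (Finset.univ.filter fun j : Fin n => h.eigenvalues j ≤ 0).card < q

/-- `ψ` is an exhaustion function of `Ω`: each sublevel set `{x ∈ Ω : ψ x < c}` is relatively
compact in `Ω`. -/
def IsExhaustionOn {M : Type*} [TopologicalSpace M] (ψ : M → ℝ) (Ω : Set M) : Prop :=
  ∀ c : ℝ, IsCompact (closure {x ∈ Ω | ψ x < c}) ∧ closure {x ∈ Ω | ψ x < c} ⊆ Ω

open scoped Topology ComplexConjugate
open Filter

/-! This is the continuity principle. Fix `z₀`, freeze the first `q` coordinates at `t * z₀ j` and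
let the others fill a closed polydisc: for `t = 0` this slice lies in the Hartogs figure, and for
every `t ∈ [0, 1]` so does its boundary, where `ρ ∘ Φ` is therefore uniformly bounded. By dimension
count, some direction in the slice has nonnegative pulled-back Levi form (`exists_ne_zero_nonneg`),
so adding `‖z‖²` rules out interior maxima (`exists_not_isLocalMax`) and the bound extends to the
whole slice. Slices inside `Ω` thus map into a fixed sublevel set whose closure lies in `Ω`, and
cannot leave `Ω` as `t` grows to 1. -/

/-- The Levi form of `φ` along `w` is a quarter of the Laplacian of `φ` along `ℂ w`. -/
lemma fderiv_fderiv_add_eq_leviForm {n : ℕ} (φ : (Fin n → ℂ) → ℝ) (z w : Fin n → ℂ) :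
    fderiv ℝ (fderiv ℝ φ) z w w + fderiv ℝ (fderiv ℝ φ) z (Complex.I • w) (Complex.I • w) =
      4 * (∑ j, ∑ k, w j * leviMatrix φ z j k * conj (w k)).re := by
  set D := fderiv ℝ (fderiv ℝ φ) z with hD
  have expand : ∀ u : Fin n → ℂ, D u u = ∑ j, ∑ k,
      ((u j).re * (u k).re * D (Pi.single j 1) (Pi.single k 1)
      + (u j).re * (u k).im * D (Pi.single j 1) (Pi.single k Complex.I)
      + (u j).im * (u k).re * D (Pi.single j Complex.I) (Pi.single k 1)
      + (u j).im * (u k).im * D (Pi.single j Complex.I) (Pi.single k Complex.I)) := by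
    intro u
    have hu : u = ∑ j, ((u j).re • (Pi.single j 1 : Fin n → ℂ) +
        (u j).im • (Pi.single j Complex.I : Fin n → ℂ)) := by
      ext i
      simp [Finset.sum_apply, Pi.single_apply, Finset.sum_add_distrib, Complex.re_add_im]
    conv_lhs => rw [hu]
    simp only [map_sum, map_add, map_smul, sum_apply, add_apply, smul_apply, smul_eq_mul]
    simp only [Finset.mul_sum, ← Finset.sum_add_distrib]
    rw [Finset.sum_comm]
    refine Finset.sum_congr rfl fun j _ => Finset.sum_congr rfl fun k _ => ?_
    ring
  rw [expand w, expand (Complex.I • w), ← Finset.sum_add_distrib, Complex.re_sum, Finset.mul_sum]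
  refine Finset.sum_congr rfl fun j _ => ?_
  rw [← Finset.sum_add_distrib, Complex.re_sum, Finset.mul_sum]
  refine Finset.sum_congr rfl fun k _ => ?_
  simp [leviMatrix, ← hD]
  ring

/-- If `q` plus the number of nonpositive eigenvalues of a Hermitian matrix is less than `n`, then
some nonzero vector whose first `q` coordinates vanish has nonnegative pulled-back Hermitian form. -/
lemma Matrix.IsHermitian.exists_ne_zero_nonneg {n q : ℕ} (hqn : q ≤ n)
    {L : Matrix (Fin n) (Fin n) ℂ} (hL : L.IsHermitian)
    (hcard : (Finset.univ.filter fun j : Fin n => hL.eigenvalues j ≤ 0).card < n - q)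
    (A : (Fin n → ℂ) →ₗ[ℂ] (Fin n → ℂ)) :
    ∃ v : Fin n → ℂ, v ≠ 0 ∧ (∀ j : Fin n, (j : ℕ) < q → v j = 0) ∧
      0 ≤ (∑ j, ∑ k, A v j * L j k * conj (A v k)).re := by
  classical
  -- The kernel of `B` imposes fewer than `q + (n - q) = n` linear conditions.
  let B : (Fin n → ℂ) →ₗ[ℂ]
      ({j : Fin n // (j : ℕ) < q} → ℂ) × ({j : Fin n // hL.eigenvalues j ≤ 0} → ℂ) :=
    LinearMap.prod (LinearMap.pi fun j => LinearMap.proj j.1)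
      (LinearMap.pi fun i => ∑ j, (hL.eigenvectorBasis i.1 j) • (LinearMap.proj j ∘ₗ A))
  have hq : Fintype.card {j : Fin n // (j : ℕ) < q} = q := by
    rw [Fintype.card_subtype]
    have := Fin.card_filter_val_lt (n := n) (m := q)
    simpa [hqn] using this
  have hB : LinearMap.ker B ≠ ⊥ := by
    apply LinearMap.ker_ne_bot_of_finrank_lt
    rw [Module.finrank_prod, Module.finrank_fintype_fun_eq_card, Module.finrank_fintype_fun_eq_card,
      Module.finrank_fintype_fun_eq_card, hq, Fintype.card_subtype, Fintype.card_fin]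
    omega
  obtain ⟨v, hv, hv0⟩ := (Submodule.ne_bot_iff _).1 hB
  rw [LinearMap.mem_ker, Prod.ext_iff] at hv
  refine ⟨v, hv0, fun j hj => congrFun hv.1 ⟨j, hj⟩, ?_⟩
  -- The conjugate turns `∑ w j * L j k * conj (w k)` into `⟪u, L u⟫`.
  set u : EuclideanSpace ℂ (Fin n) := WithLp.toLp 2 fun j => conj (A v j) with hu
  set b := hL.eigenvectorBasis with hb
  have hzero : ∀ i, hL.eigenvalues i ≤ 0 → inner ℂ (b i) u = 0 := by
    intro i hi
    have h : ∑ j, b i j * A v j = 0 := by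
      simpa [B] using congrFun hv.2 ⟨i, hi⟩
    have h2 := congrArg conj h
    rw [map_sum, map_zero] at h2
    rw [PiLp.inner_apply, ← h2]
    refine Finset.sum_congr rfl fun j _ => ?_
    simp [hu, mul_comm]
  have hform : (∑ j, ∑ k, A v j * L j k * conj (A v k)) =
      inner ℂ u (WithLp.toLp 2 (L.mulVec u.ofLp)) := by
    rw [PiLp.inner_apply]
    refine Finset.sum_congr rfl fun j _ => ?_
    simp only [hu, Matrix.mulVec, dotProduct, RCLike.inner_apply, Complex.conj_conj,
      Finset.sum_mul]
    refine Finset.sum_congr rfl fun k _ => ?_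
    ring
  have hbi : ∀ i, inner ℂ (b i) (WithLp.toLp 2 (L.mulVec u.ofLp)) =
      (hL.eigenvalues i : ℂ) * inner ℂ (b i) u := by
    intro i
    have h1 := (Matrix.isSymmetric_toEuclideanLin_iff.2 hL) (b i) u
    have h2 := hL.mulVec_eigenvectorBasis i
    have h3 : Matrix.toEuclideanLin L (b i) = (hL.eigenvalues i : ℂ) • b i := by
      rw [Matrix.toLpLin_apply]
      ext j
      simpa using congrFun h2 j
    rw [h3, inner_smul_left, Complex.conj_ofReal] at h1
    rw [h1, Matrix.toLpLin_apply]
  rw [hform, ← b.sum_inner_mul_inner, Complex.re_sum]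
  refine Finset.sum_nonneg fun i _ => ?_
  rcases le_or_gt (hL.eigenvalues i) 0 with hi | hi
  · rw [hbi, hzero i hi]; simp
  · rw [hbi, ← inner_conj_symm u (b i), mul_left_comm, Complex.conj_mul', Complex.re_ofReal_mul]
    refine mul_nonneg hi.le ?_
    rw [← Complex.ofReal_pow, Complex.ofReal_re]
    positivity

/-- The second derivative of a function at a local maximum is nonpositive. -/
lemma IsLocalMax.second_deriv_nonpos {k k' : ℝ → ℝ} {a c : ℝ} (hmax : IsLocalMax k a)
    (hk : ∀ᶠ t in 𝓝 a, HasDerivAt k (k' t) t) (hk' : HasDerivAt k' c a) : c ≤ 0 := by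
  by_contra! hc
  have hd : deriv k =ᶠ[𝓝 a] k' := hk.mono fun t ht => ht.deriv
  have hdd : deriv (deriv k) a = c := hd.deriv_eq.trans hk'.deriv
  -- Being both a local minimum and a local maximum makes `k` locally constant, so `c = 0`.
  have hmin : IsLocalMin k a :=
    isLocalMin_of_deriv_deriv_pos (hdd ▸ hc) hmax.deriv_eq_zero hk.self_of_nhds.continuousAt
  have hconst : k =ᶠ[𝓝 a] fun _ => k a := by
    filter_upwards [hmin, hmax] with t h1 h2 using le_antisymm h2 h1
  have : deriv k =ᶠ[𝓝 a] fun _ => 0 := by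
    simpa using hconst.deriv
  have h0 := this.deriv_eq
  rw [hdd] at h0
  simp at h0
  exact hc.ne' h0

/-- The Laplacian of `g ∘ γ + Re (a ζ) + c |ζ|²` is nonpositive at a local maximum, for `g` of
class `C²` and `γ` a holomorphic curve. -/
lemma laplacian_comp_curve_nonpos {E : Type*} [NormedAddCommGroup E] [NormedSpace ℂ E]
    [CompleteSpace E] {g : E → ℝ} {γ : ℂ → E} (hγ : AnalyticAt ℂ γ 0)
    (hg : ContDiffAt ℝ 2 g (γ 0)) (a : ℂ) (c : ℝ)
    (hmax : IsLocalMax (fun ζ : ℂ => g (γ ζ) + ((a * ζ).re + c * ‖ζ‖ ^ 2)) 0) :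
    fderiv ℝ (fderiv ℝ g) (γ 0) (deriv γ 0) (deriv γ 0) +
      fderiv ℝ (fderiv ℝ g) (γ 0) (Complex.I • deriv γ 0) (Complex.I • deriv γ 0) + 4 * c ≤ 0 := by
  have hgd : ∀ᶠ y in 𝓝 (γ 0), HasFDerivAt g (fderiv ℝ g y) y :=
    (hg.eventually (by simp)).mono fun y hy => (hy.differentiableAt (by simp)).hasFDerivAt
  have hgdd : HasFDerivAt (fderiv ℝ g) (fderiv ℝ (fderiv ℝ g) (γ 0)) (γ 0) :=
    ((hg.fderiv_right (m := 1) (by norm_num)).differentiableAt (by simp)).hasFDerivAt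
  have hline : ∀ (θ : ℂ) (t : ℝ), HasDerivAt (fun t : ℝ => (t : ℂ) * θ) θ t := fun θ t => by
    simpa using (Complex.ofRealCLM.hasDerivAt (x := t)).mul_const θ
  have htend : ∀ θ : ℂ, Tendsto (fun t : ℝ => (t : ℂ) * θ) (𝓝 0) (𝓝 0) := fun θ => by
    simpa using (hline θ 0).continuousAt.tendsto
  have hγd : ∀ᶠ ζ in 𝓝 (0 : ℂ), HasDerivAt γ (deriv γ ζ) ζ :=
    hγ.eventually_analyticAt.mono fun ζ h => h.differentiableAt.hasDerivAt
  have first : ∀ θ : ℂ, ∀ᶠ t : ℝ in 𝓝 0, HasDerivAt (fun t : ℝ => g (γ (t * θ)))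
      (fderiv ℝ g (γ (t * θ)) (θ • deriv γ (t * θ))) t := by
    intro θ
    filter_upwards [(htend θ).eventually hγd,
      (htend θ).eventually (hγ.continuousAt.eventually hgd)] with t h1 h2
    exact h2.comp_hasDerivAt t (h1.scomp t (hline θ t))
  -- The `γ''` term carries `θ ^ 2`, so it cancels between `θ = 1` and `θ = I`.
  have second : ∀ θ : ℂ, HasDerivAt
      (fun t : ℝ => fderiv ℝ g (γ (t * θ)) (θ • deriv γ (t * θ)))
      (fderiv ℝ (fderiv ℝ g) (γ 0) (θ • deriv γ 0) (θ • deriv γ 0) +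
        fderiv ℝ g (γ 0) ((θ ^ 2) • deriv (deriv γ) 0)) 0 := by
    intro θ
    have e0 : ((0 : ℝ) : ℂ) * θ = 0 := by simp
    have h1 : HasDerivAt (fun t : ℝ => γ (t * θ)) (θ • deriv γ 0) 0 := by
      have := hγ.differentiableAt.hasDerivAt
      rw [← e0] at this
      simpa [Function.comp_def] using this.scomp (0 : ℝ) (hline θ 0)
    have h2 : HasDerivAt (fun t : ℝ => deriv γ (t * θ)) (θ • deriv (deriv γ) 0) 0 := by
      have := hγ.deriv.differentiableAt.hasDerivAt
      rw [← e0] at this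
      simpa [Function.comp_def] using this.scomp (0 : ℝ) (hline θ 0)
    have h3 : HasDerivAt (fun t : ℝ => fderiv ℝ g (γ (t * θ)))
        (fderiv ℝ (fderiv ℝ g) (γ 0) (θ • deriv γ 0)) 0 := by
      refine HasFDerivAt.comp_hasDerivAt (0 : ℝ) ?_ h1
      rw [e0]
      exact hgdd
    have h4 := h3.clm_apply (h2.const_smul θ)
    simpa [smul_smul, sq] using h4
  -- The polynomial is the sum of the quadratic perturbation at `t` and at `t * I`.
  have hpoly : ∀ t : ℝ, HasDerivAt (fun t : ℝ => (a.re - a.im) * t + 2 * c * t ^ 2)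
      ((a.re - a.im) + 4 * c * t) t := fun t => by
    refine (((hasDerivAt_id t).const_mul (a.re - a.im)).add
      ((hasDerivAt_pow 2 t).const_mul (2 * c))).congr_deriv ?_
    norm_num
    ring
  have hpoly' : HasDerivAt (fun t : ℝ => (a.re - a.im) + 4 * c * t) (4 * c) 0 := by
    simpa using ((hasDerivAt_id (0 : ℝ)).const_mul (4 * c)).const_add (a.re - a.im)
  have hmax' : IsLocalMax (fun t : ℝ => g (γ (t * 1)) + g (γ (t * Complex.I)) +
      ((a.re - a.im) * t + 2 * c * t ^ 2)) 0 := by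
    filter_upwards [(htend 1).eventually hmax, (htend Complex.I).eventually hmax] with t h1 h2
    simp only [mul_one, Complex.mul_re, Complex.ofReal_re, Complex.ofReal_im, Complex.mul_im,
      Complex.I_re, Complex.I_im, norm_mul, Complex.norm_I, Complex.norm_real, Real.norm_eq_abs,
      sq_abs, norm_zero, Complex.zero_re, mul_zero] at h1 h2
    simp only [mul_one, Complex.ofReal_zero, zero_mul]
    linarith
  have hsecond := ((second 1).add (second Complex.I)).add hpoly'
  have := hmax'.second_deriv_nonpos (by
    filter_upwards [first 1, first Complex.I] with t h1 h2
    exact (h1.add h2).add (hpoly t)) hsecond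
  simp at this
  linarith

/-- A `q`-convexity condition pulled back by a holomorphic map, plus a strictly plurisubharmonic
term, excludes local maxima in some complex direction tangent to the last `n - q` coordinates. -/
lemma IsQConvexOn.exists_not_isLocalMax {M : Type*} [TopologicalSpace M] {n : ℕ}
    [ChartedSpace (Fin n → ℂ) M] [IsManifold 𝓘(ℂ, Fin n → ℂ) 1 M] {q : ℕ} (hqn : q ≤ n)
    {Ω : Set M} (hΩ : IsOpen Ω) {ρ : M → ℝ} (hρ : IsQConvexOn n (n - q) ρ Ω)
    {Φ : (Fin n → ℂ) → M} {U : Set (Fin n → ℂ)} (hU : IsOpen U)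
    (hΦ : MDifferentiableOn 𝓘(ℂ, Fin n → ℂ) 𝓘(ℂ, Fin n → ℂ) Φ U) {z : Fin n → ℂ} (hz : z ∈ U)
    (hzΩ : Φ z ∈ Ω) :
    ∃ v : Fin n → ℂ, (∀ j : Fin n, (j : ℕ) < q → v j = 0) ∧
      ¬ IsLocalMax (fun ζ : ℂ => ρ (Φ (z + ζ • v)) + ∑ j, ‖(z + ζ • v) j‖ ^ 2) 0 := by
  set e := chartAt (Fin n → ℂ) (Φ z) with he
  obtain ⟨hL, hcard⟩ := hρ.2 _ hzΩ
  have hg : ContDiffAt ℝ 2 (ρ ∘ e.symm) (e (Φ z)) := by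
    have h := (contMDiffWithinAt_iff.1 (hρ.1 _ hzΩ)).2
    simp only [mfld_simps] at h
    refine h.contDiffAt ?_
    exact (e.continuousAt_symm (mem_chart_target _ _)).preimage_mem_nhds
      (by rw [e.left_inv (mem_chart_source _ _)]; exact hΩ.mem_nhds hzΩ)
  have hcont : ContinuousAt Φ z := (hΦ z hz).continuousWithinAt.continuousAt (hU.mem_nhds hz)
  have hmem : ∀ᶠ y in 𝓝 z, Φ y ∈ e.source :=
    hcont.eventually (e.open_source.mem_nhds (mem_chart_source _ _))
  have hF : ∀ᶠ y in 𝓝 z, DifferentiableAt ℂ (e ∘ Φ) y := by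
    filter_upwards [hmem, hU.mem_nhds hz] with y hy hyU
    have h1 := mdifferentiableAt_atlas (I := 𝓘(ℂ, Fin n → ℂ)) (chart_mem_atlas _ (Φ z)) hy
    have h2 := (hΦ y hyU).mdifferentiableAt (hU.mem_nhds hyU)
    exact (h1.comp y h2).differentiableAt
  obtain ⟨v, hv0, hvq, hv⟩ := hL.exists_ne_zero_nonneg hqn hcard
    (fderiv ℂ (e ∘ Φ) z : (Fin n → ℂ) →ₗ[ℂ] (Fin n → ℂ))
  refine ⟨v, hvq, fun hmax => ?_⟩
  set γ : ℂ → (Fin n → ℂ) := fun ζ => (e ∘ Φ) (z + ζ • v) with hγ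
  have hl : ∀ ζ : ℂ, HasDerivAt (fun ζ : ℂ => z + ζ • v) v ζ := fun ζ => by
    simpa using ((hasDerivAt_id ζ).smul_const v).const_add z
  have hl0 : Tendsto (fun ζ : ℂ => z + ζ • v) (𝓝 0) (𝓝 z) := by
    simpa using (hl 0).continuousAt.tendsto
  have hγa : AnalyticAt ℂ γ 0 := by
    rw [Complex.analyticAt_iff_eventually_differentiableAt]
    filter_upwards [hl0.eventually hF] with ζ hζ
    exact DifferentiableAt.comp (g := e ∘ Φ) ζ hζ (hl ζ).differentiableAt
  have hγ0 : γ 0 = e (Φ z) := by simp [hγ]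
  have hγd : deriv γ 0 = fderiv ℂ (e ∘ Φ) z v := by
    have h1 := hF.self_of_nhds.hasFDerivAt
    have e0 : z + (0 : ℂ) • v = z := by simp
    rw [← e0] at h1
    exact (h1.comp_hasDerivAt (0 : ℂ) (hl 0)).deriv.trans (by rw [e0])
  have hpos : 0 < ∑ j, ‖v j‖ ^ 2 := by
    obtain ⟨j, hj⟩ := Function.ne_iff.1 hv0
    exact Finset.sum_pos' (fun _ _ => by positivity)
      ⟨j, Finset.mem_univ _, by have := norm_pos_iff.2 hj; positivity⟩
  -- The pulled-back Levi form may vanish along `v`; the `|ζ|²` coefficient, positive as `v ≠ 0`,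
  -- supplies strictness.
  have hquad : ∀ ζ : ℂ, ∑ j, ‖(z + ζ • v) j‖ ^ 2 = ∑ j, ‖z j‖ ^ 2 +
      (((2 * ∑ j, v j * conj (z j)) * ζ).re + (∑ j, ‖v j‖ ^ 2) * ‖ζ‖ ^ 2) := by
    intro ζ
    rw [Finset.mul_sum, Finset.sum_mul, Finset.sum_mul, Complex.re_sum, ← Finset.sum_add_distrib,
      ← Finset.sum_add_distrib]
    refine Finset.sum_congr rfl fun j _ => ?_
    simp only [Pi.add_apply, Pi.smul_apply, smul_eq_mul, ← Complex.normSq_eq_norm_sq,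
      Complex.normSq_apply]
    simp
    ring
  have hmax' : IsLocalMax (fun ζ : ℂ => (ρ ∘ e.symm) (γ ζ) +
      (((2 * ∑ j, v j * conj (z j)) * ζ).re + (∑ j, ‖v j‖ ^ 2) * ‖ζ‖ ^ 2)) 0 := by
    filter_upwards [hmax, hl0.eventually hmem] with ζ h1 h2
    rw [hquad, hquad] at h1
    simp only [hγ, Function.comp_apply, e.left_inv h2, zero_smul, add_zero,
      e.left_inv (mem_chart_source _ (Φ z))] at h1 ⊢
    linarith
  have hfin := laplacian_comp_curve_nonpos hγa (hγ0 ▸ hg) _ _ hmax'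
  have hlevi := fderiv_fderiv_add_eq_leviForm (ρ ∘ e.symm) (γ 0) (deriv γ 0)
  rw [hlevi, hγd, hγ0] at hfin
  have hv' : 0 ≤ (∑ j, ∑ k, fderiv ℂ (e ∘ Φ) z v j * leviMatrix (ρ ∘ e.symm) (e (Φ z)) j k *
    conj (fderiv ℂ (e ∘ Φ) z v k)).re := hv
  linarith

theorem mainTheorem8 {M : Type*} [TopologicalSpace M] [T2Space M] (n : ℕ)
    [ChartedSpace (Fin n → ℂ) M] [IsManifold 𝓘(ℂ, Fin n → ℂ) 1 M]
    (q : ℕ) (hq1 : 1 ≤ q) (hqn : q ≤ n - 1)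
    (Ω : Set M) (hΩ : IsOpen Ω)
    (hex : ∃ ρ : M → ℝ, IsQConvexOn n (n - q) ρ Ω ∧ IsExhaustionOn ρ Ω) :
    IsQPseudoconvex n q Ω := by
  obtain ⟨ρ, hρ, hexh⟩ := hex
  rintro r s hr hr1 hs hs1 Φ hΦ - hH _ ⟨z₀, hz₀, rfl⟩
  have hpoly : unitPolydisc n = Metric.ball 0 1 := by
    ext z
    rw [mem_ball_zero_iff, pi_norm_lt_iff one_pos]
    rfl
  have hU : IsOpen (unitPolydisc n) := hpoly ▸ Metric.isOpen_ball
  have hz₀' : ‖z₀‖ < 1 := (pi_norm_lt_iff one_pos).2 hz₀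
  -- `s < s'` puts the boundaries of the slices in the Hartogs figure; `‖z₀‖ < s'` puts `z₀` in the
  -- slice at `t = 1`.
  obtain ⟨s', hss', hs'1⟩ := exists_between (max_lt hs1 hz₀')
  obtain ⟨hss', hzs'⟩ := max_lt_iff.1 hss'
  have hs'0 : 0 < s' := hs.trans hss'
  have hz₀s (j : Fin n) : ‖z₀ j‖ < s' := (norm_le_pi_norm z₀ j).trans_lt hzs'
  -- the family of discs, parametrized by a polydisc of radius `s'`
  let P : ℝ × (Fin n → ℂ) → (Fin n → ℂ) := fun p j => if (j : ℕ) < q then p.1 * z₀ j else p.2 j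
  have hP : Continuous P := by
    refine continuous_pi fun j => ?_
    by_cases hj : (j : ℕ) < q
    · simp only [P, hj, if_true]; fun_prop
    · simp only [P, hj, if_false]; fun_prop
  set K : Set (Fin n → ℂ) := Metric.closedBall 0 s' with hK
  have hKc : IsCompact K := isCompact_closedBall _ _
  have hKmem {z : Fin n → ℂ} : z ∈ K ↔ ∀ j, ‖z j‖ ≤ s' := by
    rw [hK, mem_closedBall_zero_iff, pi_norm_le_iff_of_nonneg hs'0.le]
  have hlow {t : ℝ} (ht : t ∈ Set.Icc (0 : ℝ) 1) (j : Fin n) : ‖(t : ℂ) * z₀ j‖ < s' := by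
    rw [norm_mul, Complex.norm_real, Real.norm_of_nonneg ht.1]
    exact (mul_le_of_le_one_left (norm_nonneg _) ht.2).trans_lt (hz₀s j)
  have hPK {t : ℝ} (ht : t ∈ Set.Icc (0 : ℝ) 1) {z : Fin n → ℂ} (hz : z ∈ K) : P (t, z) ∈ K := by
    refine hKmem.2 fun j => ?_
    by_cases hj : (j : ℕ) < q
    · simpa only [P, hj, if_true] using (hlow ht j).le
    · simpa only [P, hj, if_false] using hKmem.1 hz j
  have hKU : K ⊆ unitPolydisc n := fun z hz j => (hKmem.1 hz j).trans_lt hs'1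
  have hΦc {z : Fin n → ℂ} (hz : z ∈ K) : ContinuousAt Φ z :=
    (hΦ z (hKU hz)).continuousWithinAt.continuousAt (hU.mem_nhds (hKU hz))
  have hΦP {t : ℝ} (ht : t ∈ Set.Icc (0 : ℝ) 1) {z : Fin n → ℂ} (hz : z ∈ K) :
      ContinuousAt (fun p => Φ (P p)) (t, z) :=
    ContinuousAt.comp (f := P) (hΦc (hPK ht hz)) hP.continuousAt
  have hρc {x : M} (hx : x ∈ Ω) : ContinuousAt ρ x :=
    (hρ.1.continuousOn x hx).continuousAt (hΩ.mem_nhds hx)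
  -- a bound on the boundaries of the discs
  obtain ⟨c, hc⟩ : ∃ c, ∀ t ∈ Set.Icc (0 : ℝ) 1, ∀ z ∈ K, (∃ j : Fin n, q ≤ (j : ℕ) ∧ ‖z j‖ = s') →
      ρ (Φ (P (t, z))) ≤ c := by
    set B : Set (ℝ × (Fin n → ℂ)) :=
      (Set.Icc 0 1 ×ˢ K) ∩ {p | ∃ j : Fin n, q ≤ (j : ℕ) ∧ ‖p.2 j‖ = s'} with hB
    have hBc : IsCompact B := by
      refine (isCompact_Icc.prod hKc).inter_right ?_
      simp only [Set.ofPred_exists]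
      refine isClosed_iUnion_of_finite fun j => isClosed_const.inter ?_
      exact isClosed_eq (by fun_prop) continuous_const
    have hBcont : ContinuousOn (fun p => ρ (Φ (P p))) B := by
      rintro ⟨t, z⟩ ⟨⟨ht, hz⟩, j, hj, hjs⟩
      have hmem : Φ (P (t, z)) ∈ Ω := by
        refine hH ⟨_, ⟨hKU (hPK ht hz), Or.inr ⟨j, hj, ?_⟩⟩, rfl⟩
        simp only at hjs
        simpa only [P, hj.not_gt, if_false, hjs] using hss'
      exact (ContinuousAt.comp (f := fun p => Φ (P p)) (hρc hmem)
        (hΦP ht hz)).continuousWithinAt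
    obtain ⟨c, hc⟩ := hBc.bddAbove_image hBcont
    exact ⟨c, fun t ht z hz h => hc ⟨(t, z), ⟨⟨ht, hz⟩, h⟩, rfl⟩⟩
  have hsum {z : Fin n → ℂ} (hz : z ∈ K) : ∑ j, ‖z j‖ ^ 2 ≤ n := by
    calc ∑ j, ‖z j‖ ^ 2 ≤ ∑ _j : Fin n, (1 : ℝ) :=
          Finset.sum_le_sum fun j _ => pow_le_one₀ (norm_nonneg _) (hKU hz j).le
      _ = n := by simp
  -- the maximum principle
  have hbound {t : ℝ} (ht : t ∈ Set.Icc (0 : ℝ) 1) (hin : ∀ z ∈ K, Φ (P (t, z)) ∈ Ω) :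
      ∀ z ∈ K, ρ (Φ (P (t, z))) ≤ c + n := by
    set G : (Fin n → ℂ) → ℝ := fun z => ρ (Φ (P (t, z))) + ∑ j, ‖P (t, z) j‖ ^ 2 with hG
    have hPt : Continuous fun z => P (t, z) := hP.comp (by fun_prop)
    have hGc : ContinuousOn G K := by
      intro z hz
      refine (ContinuousAt.add ?_ ?_).continuousWithinAt
      · exact ContinuousAt.comp (f := fun z => Φ (P (t, z))) (hρc (hin z hz))
          (ContinuousAt.comp (f := fun z => P (t, z)) (hΦc (hPK ht hz)) hPt.continuousAt)
      · exact Continuous.continuousAt (by fun_prop)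
    obtain ⟨z₁, hz₁, hmax⟩ := hKc.exists_isMaxOn ⟨0, Metric.mem_closedBall_self hs'0.le⟩ hGc
    suffices h : G z₁ ≤ c + n by
      intro z hz
      have h1 : G z ≤ G z₁ := hmax hz
      have h2 : 0 ≤ ∑ j, ‖P (t, z) j‖ ^ 2 := Finset.sum_nonneg fun _ _ => by positivity
      simp only [hG] at h1 h
      linarith
    by_cases hbd : ∃ j : Fin n, q ≤ (j : ℕ) ∧ ‖z₁ j‖ = s'
    · exact add_le_add (hc t ht z₁ hz₁ hbd) (hsum (hPK ht hz₁))
    · exfalso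
      push Not at hbd
      obtain ⟨v, hv, hnot⟩ := hρ.exists_not_isLocalMax (by omega) hΩ hU hΦ
        (hKU (hPK ht hz₁)) (hin z₁ hz₁)
      apply hnot
      have hw : P (t, z₁) ∈ Metric.ball (0 : Fin n → ℂ) s' := by
        rw [mem_ball_zero_iff, pi_norm_lt_iff hs'0]
        intro j
        by_cases hj : (j : ℕ) < q
        · simpa only [P, hj, if_true] using hlow ht j
        · simpa only [P, hj, if_false] using
            lt_of_le_of_ne (hKmem.1 hz₁ j) (hbd j (not_lt.1 hj))
      have hcl : Tendsto (fun ζ : ℂ => P (t, z₁) + ζ • v) (𝓝 0) (𝓝 (P (t, z₁))) := by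
        have : Continuous fun ζ : ℂ => P (t, z₁) + ζ • v := by fun_prop
        simpa using this.tendsto 0
      -- Since `v` vanishes in the first `q` coordinates, the complex line stays in the slice, so
      -- the maximum over `K` is a local maximum along it.
      have hfix (ζ : ℂ) : P (t, P (t, z₁) + ζ • v) = P (t, z₁) + ζ • v := by
        ext j
        by_cases hj : (j : ℕ) < q
        · simp [P, hj, hv j hj]
        · simp [P, hj]
      have hfix0 : P (t, P (t, z₁)) = P (t, z₁) := by simpa using hfix 0
      filter_upwards [hcl.eventually (Metric.isOpen_ball.mem_nhds hw)] with ζ hζ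
      have h1 : G (P (t, z₁) + ζ • v) ≤ G z₁ := hmax (Metric.ball_subset_closedBall hζ)
      simp only [hG, hfix] at h1
      simpa using h1
  -- the continuity argument
  set L := closure {x ∈ Ω | ρ x < c + n + 1} with hL
  have hLΩ : L ⊆ Ω := (hexh _).2
  have hinL {t : ℝ} (ht : t ∈ Set.Icc (0 : ℝ) 1) (hin : ∀ z ∈ K, Φ (P (t, z)) ∈ Ω) :
      ∀ z ∈ K, Φ (P (t, z)) ∈ L := fun z hz =>
    subset_closure ⟨hin z hz, (hbound ht hin z hz).trans_lt (lt_add_one _)⟩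
  -- The set of good `t` is closed because `L` is. It is open to the right: compactness of `K` keeps
  -- nearby slices in `Ω`, and the bound then returns them to `L`.
  have hsub : Set.Icc (0 : ℝ) 1 ⊆ {t | ∀ z ∈ K, Φ (P (t, z)) ∈ L} := by
    refine IsClosed.Icc_subset_of_forall_mem_nhdsWithin ?_ ?_ ?_
    · have : {t | ∀ z ∈ K, Φ (P (t, z)) ∈ L} ∩ Set.Icc (0 : ℝ) 1 =
          Set.Icc 0 1 ∩ ⋂ z ∈ K, (Set.Icc 0 1 ∩ (fun t => Φ (P (t, z))) ⁻¹' L) := by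
        ext t
        simp only [Set.mem_inter_iff, Set.mem_ofPred_eq, Set.mem_iInter, Set.mem_preimage]
        exact ⟨fun h => ⟨h.2, fun z hz => ⟨h.2, h.1 z hz⟩⟩, fun h => ⟨fun z hz => (h.2 z hz).2, h.1⟩⟩
      rw [this]
      refine isClosed_Icc.inter (isClosed_biInter fun z hz => ?_)
      refine ContinuousOn.preimage_isClosed_of_isClosed (fun t ht => ?_) isClosed_Icc isClosed_closure
      exact (ContinuousAt.comp (f := fun t : ℝ => (t, z)) (g := fun p => Φ (P p)) (hΦP ht hz)
        (by fun_prop)).continuousWithinAt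
    · refine hinL (by simp) fun z hz => ?_
      have h0 : (0 : ℝ) ∈ Set.Icc (0 : ℝ) 1 := by simp
      refine hH ⟨_, ⟨hKU (hPK h0 hz), Or.inl fun j hj => ?_⟩, rfl⟩
      simpa [P, hj] using hr
    · rintro t ⟨ht, ht1⟩
      have htI : t ∈ Set.Icc (0 : ℝ) 1 := Set.Ico_subset_Icc_self ht1
      have hev : ∀ᶠ t' in 𝓝 t, ∀ z ∈ K, Φ (P (t', z)) ∈ Ω :=
        hKc.eventually_forall_of_forall_eventually fun z hz =>
          (hΦP htI hz).eventually (hΩ.mem_nhds (hLΩ (ht z hz)))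
      filter_upwards [nhdsWithin_le_nhds hev, Icc_mem_nhdsGT_of_mem ht1] with t' h1 h2
      exact hinL h2 h1
  have hfinal : Φ (P (1, z₀)) ∈ L := hsub (by simp) z₀ (hKmem.2 fun j => (hz₀s j).le)
  have hP1 : P (1, z₀) = z₀ := by
    ext j
    simp [P]
  exact hLΩ (hP1 ▸ hfinal)
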